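/- Let $p\ge 0$ be an integer, and let all matrices and vectors have real, or all have complex, entries. For $i=1,\dots,p$ let $A_{II}^{(i)}$ (square), $A_{I\Gamma}^{(i)}$, $A_{\Gamma I}^{(i)}$, $A_{\Gamma\Gamma}^{(i)}$ be the blocks of the matrix of the $i$-th subdomain and $b_I^{(i)}$, $b_\Gamma^{(i)}$ those of its right-hand side, where $I$ stands for the interior unknowns of subdomain $i$ and $\Gamma$ for the finite set of interface unknowns, common to all subdomains. Put $A_{\Gamma\Gamma}=\sum_{i=1}^p A_{\Gamma\Gamma}^{(i)}$; let $M_{\Gamma\Gamma}$ be a square matrix on $\Gamma$ and let $I_{\Gamma\Gamma}^{(1)},\dots,I_{\Gamma\Gamma}^{(p)}$ be square matrices on $\Gamma$ whose sum is the identity matrix. Set $$A=\begin{bmatrix}A_{II}^{(1)}&&&A_{I\Gamma}^{(1)}\\&\ddots&&\vdots\\&&A_{II}^{(p)}&A_{I\Gamma}^{(p)}\\A_{\Gamma I}^{(1)}&\cdots&A_{\Gamma I}^{(p)}&A_{\Gamma\Gamma}\end{bmatrix},\qquad M=\begin{bmatrix}A_{II}^{(1)}&&&\\&\ddots&&\\&&A_{II}^{(p)}&\\&&&M_{\Gamma\Gamma}\end{bmatrix}$$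 (blank blocks are zero), $S^{(i)}=A_{\Gamma\Gamma}^{(i)}-A_{\Gamma I}^{(i)}(A_{II}^{(i)})^{-1}A_{I\Gamma}^{(i)}$, $d^{(i)}=b_\Gamma^{(i)}-A_{\Gamma I}^{(i)}(A_{II}^{(i)})^{-1}b_I^{(i)}$, $S=\sum_i S^{(i)}$ and $d=\sum_i d^{(i)}$. The asynchronous primal Schur method generates interface vectors $x^{(i),k}$ ($1\le i\le p$, $k\ge 0$), from arbitrary $x^{(1),0},\dots,x^{(p),0}$, by $$y^{(i),k}=I_{\Gamma\Gamma}^{(i)}x^{(i),k}+M_{\Gamma\Gamma}^{-1}\bigl(d^{(i)}-S^{(i)}x^{(i),k}\bigr),\qquad x^{(i),k+1}=\begin{cases}\sum_{j=1}^p y^{(j),\tau_j^i(k)},& i\in P^{(k)},\\ x^{(i),k},& i\notin P^{(k)},\end{cases}$$ where $P^{(k)}\subseteq\{1,\dots,p\}$, each $i$ belongs to infinitely many $P^{(k)}$, $\tau_j^i(k)\le k$, and $\tau_j^i(k)\to\infty$ as $k\to\infty$ for all $i,j$. The method is called convergent if $Sx=d$ has a unique solution $x^*$ and, for all such $P^{(k)}$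 and $\tau_j^i$ and all initial vectors, $x^{(i),k}\to x^*$ as $k\to\infty$ for every $i$. Let $|B|$ be the matrix of the absolute values of the entries of $B$, let $\rho$ be the spectral radius, and for a square matrix $B=(b_{ij})$ let $\langle B\rangle$ be the matrix with diagonal entries $|b_{ii}|$ and off-diagonal entries $-|b_{ij}|$. A real square matrix $B$ is an $\mathsf M$-matrix if for some real $\alpha$ the matrix $\alpha I-B$ has nonnegative entries and $\rho(\alpha I-B)<\alpha$. A square matrix $B$ is an $\mathsf H$-matrix if $\langle B\rangle$ is an $\mathsf M$-matrix. A splitting $A=M-N$ is an $\mathsf H$-splitting if $M$ is non-singular and $\langle M\rangle-|N|$ is an $\mathsf M$-matrix. Suppose that $$\sum_{i=1}^p\bigl|I_{\Gamma\Gamma}^{(i)}-M_{\Gamma\Gamma}^{-1}A_{\Gamma\Gamma}^{(i)}\bigr|=\Bigl|\sum_{i=1}^p\bigl(I_{\Gamma\Gamma}^{(i)}-M_{\Gamma\Gamma}^{-1}A_{\Gamma\Gamma}^{(i)}\bigr)\Bigr|,$$ that $A$ is an $\mathsf H$-matrix, and that $\langle M_{\Gamma\Gamma}\rangle-|M_{\Gamma\Gamma}-A_{\Gamma\Gamma}|=\langle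 A_{\Gamma\Gamma}\rangle$. (The last two conditions imply that $M_{\Gamma\Gamma}$ and all the $A_{II}^{(i)}$ are non-singular.) Then the asynchronous primal Schur method is convergent. Moreover, $A=M-(M-A)$ is an $\mathsf H$-splitting, and $\rho(|I-M^{-1}A|)<1$. -/

import Mathlib

open Filter Topology
open scoped ENNReal

namespace AsyncSchur

noncomputable section

section MatrixNotions

variable {𝕜 : Type*} [RCLike 𝕜]

/-- The entry-wise absolute value `|A|` of a real or complex matrix, as a real matrix. -/
def absMat {m n : Type*} (A : Matrix m n 𝕜) : Matrix m n ℝ :=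
  Matrix.of fun i j => ‖A i j‖

/-- The spectral radius of a real square matrix: the largest modulus of its complex eigenvalues
(and `0` for the empty matrix). -/
def specRad {n : Type*} [Fintype n] [DecidableEq n] (T : Matrix n n ℝ) : ℝ≥0∞ :=
  spectralRadius ℂ (T.map (fun t : ℝ => (t : ℂ)))

/-- A real square matrix `A` is an M-matrix if, for some real `α`, the matrix `α I - A` is
entry-wise nonnegative and `ρ(α I - A) < α`. -/
def IsMMatrix {n : Type*} [Fintype n] [DecidableEq n] (A : Matrix n n ℝ) : Prop :=
  ∃ α : ℝ, (∀ i j, 0 ≤ (α • (1 : Matrix n n ℝ) - A) i j) ∧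
    specRad (α • (1 : Matrix n n ℝ) - A) < ENNReal.ofReal α

/-- The comparison matrix `⟨A⟩`. -/
def compMat {n : Type*} [DecidableEq n] (A : Matrix n n 𝕜) : Matrix n n ℝ :=
  Matrix.of fun i j => if i = j then ‖A i j‖ else -‖A i j‖

/-- A square matrix is an H-matrix if its comparison matrix is an M-matrix. -/
def IsHMatrix {n : Type*} [Fintype n] [DecidableEq n] (A : Matrix n n 𝕜) : Prop :=
  IsMMatrix (compMat A)

/-- `A = M - N` is an H-splitting: `M` is non-singular and `⟨M⟩ - |N|` is an M-matrix. -/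
structure IsHSplitting {n : Type*} [Fintype n] [DecidableEq n] (A M N : Matrix n n 𝕜) :
    Prop where
  eq_sub : A = M - N
  nonsingular : IsUnit M
  isMMatrix : IsMMatrix (compMat M - absMat N)

end MatrixNotions

/-- The data of a linear system over `p` nonoverlapping subdomains with interior index sets `ι i`
and common interface `Γ`: for each subdomain `i`, the blocks `A_II`, `A_IΓ`, `A_ΓI`, `A_ΓΓ` of its
matrix and the blocks `b_I`, `b_Γ` of its right-hand side. -/
structure SubdomainData (𝕜 : Type*) (p : ℕ) (ι : Fin p → Type*) (Γ : Type*) where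
  AII : (i : Fin p) → Matrix (ι i) (ι i) 𝕜
  AIG : (i : Fin p) → Matrix (ι i) Γ 𝕜
  AGI : (i : Fin p) → Matrix Γ (ι i) 𝕜
  AGG : Fin p → Matrix Γ Γ 𝕜
  bI : (i : Fin p) → ι i → 𝕜
  bG : Fin p → Γ → 𝕜

namespace SubdomainData

variable {𝕜 : Type*} [RCLike 𝕜] {p : ℕ} {ι : Fin p → Type*} {Γ : Type*}
  [∀ i, Fintype (ι i)] [∀ i, DecidableEq (ι i)] [Fintype Γ] [DecidableEq Γ]

/-- The assembled interface block `A_ΓΓ = ∑ i, A_ΓΓ^(i)`. -/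
def interfaceBlock (D : SubdomainData 𝕜 p ι Γ) : Matrix Γ Γ 𝕜 := ∑ i, D.AGG i

/-- The global matrix `A` (interior unknowns of all subdomains first, then the interface). -/
def globalMatrix (D : SubdomainData 𝕜 p ι Γ) :
    Matrix ((Σ i, ι i) ⊕ Γ) ((Σ i, ι i) ⊕ Γ) 𝕜 :=
  Matrix.fromBlocks (Matrix.blockDiagonal' D.AII)
    (Matrix.of fun (a : Σ i, ι i) (g : Γ) => D.AIG a.1 a.2 g)
    (Matrix.of fun (g : Γ) (a : Σ i, ι i) => D.AGI a.1 g a.2)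
    D.interfaceBlock

/-- The block diagonal matrix `M` with blocks `A_II^(1), …, A_II^(p), M_ΓΓ`. -/
def splittingMatrix (D : SubdomainData 𝕜 p ι Γ) (MGG : Matrix Γ Γ 𝕜) :
    Matrix ((Σ i, ι i) ⊕ Γ) ((Σ i, ι i) ⊕ Γ) 𝕜 :=
  Matrix.fromBlocks (Matrix.blockDiagonal' D.AII) 0 0 MGG

/-- The local Schur complement `S^(i) = A_ΓΓ^(i) - A_ΓI^(i) (A_II^(i))⁻¹ A_IΓ^(i)`. -/
def localSchur (D : SubdomainData 𝕜 p ι Γ) (i : Fin p) : Matrix Γ Γ 𝕜 :=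
  D.AGG i - D.AGI i * (D.AII i)⁻¹ * D.AIG i

/-- The condensed right-hand side `d^(i) = b_Γ^(i) - A_ΓI^(i) (A_II^(i))⁻¹ b_I^(i)`. -/
def localRhs (D : SubdomainData 𝕜 p ι Γ) (i : Fin p) : Γ → 𝕜 :=
  D.bG i - (D.AGI i * (D.AII i)⁻¹).mulVec (D.bI i)

/-- The global Schur complement. -/
def schur (D : SubdomainData 𝕜 p ι Γ) : Matrix Γ Γ 𝕜 := ∑ i, D.localSchur i

/-- The right-hand side of the interface problem. -/
def rhs (D : SubdomainData 𝕜 p ι Γ) : Γ → 𝕜 := ∑ i, D.localRhs i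

/-- The contribution `y^(i) = I^(i) x + M_ΓΓ⁻¹ (d^(i) - S^(i) x)` that subdomain `i` computes from
its current interface vector `x`; `W i` stands for `I^(i)`. -/
def contribution (D : SubdomainData 𝕜 p ι Γ) (MGG : Matrix Γ Γ 𝕜) (W : Fin p → Matrix Γ Γ 𝕜)
    (i : Fin p) (x : Γ → 𝕜) : Γ → 𝕜 :=
  (W i).mulVec x + MGG⁻¹.mulVec (D.localRhs i - (D.localSchur i).mulVec x)

end SubdomainData

/-- Admissible update sets `P^(k)` and access times `τ i j k = τ_j^i(k)`: every component is updated
infinitely often, no data is read before it exists, and outdated data is eventually discarded. -/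
structure IsAsyncSchedule {p : ℕ} (P : ℕ → Set (Fin p)) (τ : Fin p → Fin p → ℕ → ℕ) : Prop where
  infinite_updates : ∀ i, {k | i ∈ P k}.Infinite
  delay_le : ∀ i j k, τ i j k ≤ k
  delay_tendsto : ∀ i j, Tendsto (τ i j) atTop atTop

section Method

variable {𝕜 : Type*} [RCLike 𝕜] {p : ℕ} {ι : Fin p → Type*} {Γ : Type*}
  [∀ i, Fintype (ι i)] [∀ i, DecidableEq (ι i)] [Fintype Γ] [DecidableEq Γ]

/-- `x k i = x_Γ^(i),k` is a run of the asynchronous primal Schur method, from arbitrary initial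
interface vectors `x 0 i`. -/
def IsAsyncSchurRun (D : SubdomainData 𝕜 p ι Γ) (MGG : Matrix Γ Γ 𝕜)
    (W : Fin p → Matrix Γ Γ 𝕜) (P : ℕ → Set (Fin p)) (τ : Fin p → Fin p → ℕ → ℕ)
    (x : ℕ → Fin p → Γ → 𝕜) : Prop :=
  ∀ k i,
    (i ∈ P k → x (k + 1) i = ∑ j, D.contribution MGG W j (x (τ i j k) j)) ∧
    (i ∉ P k → x (k + 1) i = x k i)

/-- The asynchronous primal Schur method is convergent: the interface problem `S x = d` has exactly
one solution, and for every admissible schedule and all initial vectors, all the iterates `x^(i),k`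
tend to it. -/
def AsyncSchurConvergent (D : SubdomainData 𝕜 p ι Γ) (MGG : Matrix Γ Γ 𝕜)
    (W : Fin p → Matrix Γ Γ 𝕜) : Prop :=
  ∃ xs : Γ → 𝕜, (∀ z : Γ → 𝕜, D.schur.mulVec z = D.rhs ↔ z = xs) ∧
    ∀ (P : ℕ → Set (Fin p)) (τ : Fin p → Fin p → ℕ → ℕ), IsAsyncSchedule P τ →
      ∀ x : ℕ → Fin p → Γ → 𝕜, IsAsyncSchurRun D MGG W P τ x →
        ∀ i, Tendsto (fun k => x k i) atTop (𝓝 xs)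

end Method

end

end AsyncSchur

/-! Everything rests on one positive vector. An M-matrix `B` has some `v > 0` with `B v > 0`. The
splitting identity on the interface extends to the global matrices, so `⟨A⟩ v > 0` reads `|M - A| v
< ⟨M⟩ v`, and finiteness gives `c < 1` with `|M - A| v ≤ c ⟨M⟩ v` (`exists_dominant_weights`). A
maximum principle for `⟨M⟩` (`norm_le_of_norm_mulVec_le`) turns this into `|M⁻¹ (M - A)| v ≤ c v`,
which bounds the spectral radius by `c`.

For the method, the interior values that an interface error `e j` induces through `(AII j)⁻¹ AIG j`
obey the same bound by `v`. Hence the linear part of an update is controlled by the interface rows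
of `|M⁻¹ (M - A)| v`; the condition on the `W i` ensures that splitting `MGG` among subdomains costs
nothing. The update thus contracts the maximum norm weighted by `v` on `Γ` with factor `c`
(`norm_updateLinear_le`), which makes asynchronous iterations converge
(`tendsto_zero_of_isAsyncSchedule`). -/

/-! ### M-matrices, positive vectors and the spectral radius. -/

open Matrix in
/-- A M-matrix is generalized strictly diagonally dominant. -/
theorem AsyncSchur.IsMMatrix.exists_pos_mulVec_pos {n : Type*} [Fintype n] [DecidableEq n]
    {B : Matrix n n ℝ} (hB : AsyncSchur.IsMMatrix B) :
    ∃ v : n → ℝ, (∀ i, 0 < v i) ∧ ∀ i, 0 < (B *ᵥ v) i := by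
  let _ : NormedRing (Matrix n n ℂ) := Matrix.linftyOpNormedRing
  let _ : NormedAlgebra ℂ (Matrix n n ℂ) := Matrix.linftyOpNormedAlgebra
  obtain ⟨α, hT, hα⟩ := hB
  set T : Matrix n n ℝ := α • (1 : Matrix n n ℝ) - B with hTdef
  have hα0 : 0 < α := ENNReal.ofReal_pos.1 (lt_of_le_of_lt (zero_le) hα)
  set C : Matrix n n ℂ := T.map (fun t : ℝ => (t : ℂ))
  -- Gelfand's formula replaces Perron–Frobenius: some power satisfies `‖C ^ N‖ < α ^ N` in the
  -- row-sum norm.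
  have hev := (spectrum.pow_norm_pow_one_div_tendsto_nhds_spectralRadius C).eventually_lt_const hα
  obtain ⟨N, hlt, hN⟩ := (hev.and (Filter.eventually_ge_atTop 1)).exists
  have hnorm : ‖C ^ N‖ < α ^ N := by
    have h1 : ‖C ^ N‖ ^ (1 / N : ℝ) < α := (ENNReal.ofReal_lt_ofReal_iff hα0).1 hlt
    have hN0 : (N : ℝ) ≠ 0 := by positivity
    calc ‖C ^ N‖ = (‖C ^ N‖ ^ (1 / N : ℝ)) ^ N := by
          rw [← Real.rpow_natCast, ← Real.rpow_mul (norm_nonneg _), one_div,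
            inv_mul_cancel₀ hN0, Real.rpow_one]
      _ < α ^ N := pow_lt_pow_left₀ h1 (by positivity) (by omega)
  have hpow : ∀ k, ∀ i j, 0 ≤ (T ^ k) i j := by
    intro k
    induction k with
    | zero =>
      intro i j
      rw [pow_zero, Matrix.one_apply]
      split_ifs <;> norm_num
    | succ k ih =>
      intro i j
      rw [pow_succ, Matrix.mul_apply]
      exact Finset.sum_nonneg fun l _ => mul_nonneg (ih i l) (hT l j)
  have hsmul : ∀ k : ℕ, (α • (1 : Matrix n n ℝ)) ^ k = α ^ k • (1 : Matrix n n ℝ) := fun k => by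
    rw [smul_pow, one_pow]
  have hgeom := (show Commute (α • (1 : Matrix n n ℝ)) T from
    (Commute.one_left T).smul_left α).mul_geom_sum₂ N
  have hBT : α • (1 : Matrix n n ℝ) - T = B := by rw [hTdef]; abel
  rw [hBT] at hgeom
  -- A truncated Neumann series applied to the ones vector: `B` sends it to `(α ^ N - T ^ N) 1`,
  -- which is positive by the norm bound. Its term `i = N - 1` alone is already positive.
  refine ⟨(∑ i ∈ Finset.range N, (α • (1 : Matrix n n ℝ)) ^ i * T ^ (N - 1 - i)) *ᵥ 1, ?_, ?_⟩
  · intro i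
    rw [Matrix.sum_mulVec, Finset.sum_apply]
    have hterm : ∀ k, 0 ≤ (T ^ k *ᵥ (1 : n → ℝ)) i := fun k => by
      exact Finset.sum_nonneg fun j _ => mul_nonneg (hpow k i j) zero_le_one
    refine Finset.sum_pos' (fun k _ => ?_) ⟨N - 1, Finset.mem_range.2 (by omega), ?_⟩
    · rw [hsmul, Matrix.smul_mul, one_mul, Matrix.smul_mulVec]
      exact mul_nonneg (by positivity) (hterm _)
    · rw [hsmul, Matrix.smul_mul, one_mul, Matrix.smul_mulVec, Nat.sub_self, pow_zero,
        Matrix.one_mulVec]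
      simpa using pow_pos hα0 (N - 1)
  · intro i
    rw [Matrix.mulVec_mulVec, hgeom, hsmul, Matrix.sub_mulVec, Matrix.smul_mulVec,
      Matrix.one_mulVec]
    have hCN : C ^ N = (T ^ N).map (fun t : ℝ => (t : ℂ)) :=
      (map_pow (Complex.ofRealHom.mapMatrix) T N).symm
    have hle : (T ^ N *ᵥ (1 : n → ℝ)) i ≤ ‖C ^ N‖ := by
      have h1 : ‖(C ^ N *ᵥ (1 : n → ℂ)) i‖ ≤ ‖C ^ N‖ := by
        refine (norm_le_pi_norm _ i).trans ((Matrix.linfty_opNorm_mulVec _ _).trans ?_)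
        refine mul_le_of_le_one_right (norm_nonneg _) ?_
        exact (pi_norm_le_iff_of_nonneg zero_le_one).2 fun j => by simp
      refine le_trans ?_ h1
      have h2 : (C ^ N *ᵥ (1 : n → ℂ)) i = (((T ^ N *ᵥ (1 : n → ℝ)) i : ℝ) : ℂ) := by
        rw [hCN]
        simp only [Matrix.mulVec, dotProduct, Matrix.map_apply, Pi.one_apply, mul_one,
          Complex.ofReal_sum]
      rw [h2, Complex.norm_real]
      exact le_abs_self _
    have := hle.trans_lt hnorm
    simpa using this

/-- A positive vector that a nonnegative matrix maps to at most `c` times itself bounds the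
spectral radius by `c`. -/
theorem AsyncSchur.specRad_le_of_mulVec_le {n : Type*} [Fintype n] [DecidableEq n]
    {T : Matrix n n ℝ} (hT : ∀ i j, 0 ≤ T i j) {v : n → ℝ} (hv : ∀ i, 0 < v i) {c : ℝ}
    (h : ∀ i, T.mulVec v i ≤ c * v i) : AsyncSchur.specRad T ≤ ENNReal.ofReal c := by
  refine iSup₂_le fun μ hμ => ?_
  rw [← Matrix.spectrum_toLin', ← Module.End.hasEigenvalue_iff_mem_spectrum] at hμ
  obtain ⟨x, hx⟩ := hμ.exists_hasEigenvector
  have hmul : (T.map (fun t : ℝ => (t : ℂ))).mulVec x = μ • x := by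
    simpa using hx.apply_eq_smul
  obtain ⟨i₀, hi₀⟩ := Function.ne_iff.1 hx.2
  have : Nonempty n := ⟨i₀⟩
  -- The eigenvalue equation is read in the row where the eigenvector is largest relative to `v`.
  obtain ⟨i, hi⟩ := Finite.exists_max fun i => ‖x i‖ / v i
  set t := ‖x i‖ / v i
  have ht0 : 0 < t := (div_pos (norm_pos_iff.2 hi₀) (hv i₀)).trans_le (hi i₀)
  have hxt : ∀ j, ‖x j‖ ≤ t * v j := fun j => (div_le_iff₀ (hv j)).1 (hi j)
  have hxi : ‖x i‖ = t * v i := (div_mul_cancel₀ _ (hv i).ne').symm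
  have key : ‖μ‖ * (t * v i) ≤ c * (t * v i) := by
    calc ‖μ‖ * (t * v i) = ‖(μ • x) i‖ := by rw [← hxi, Pi.smul_apply, norm_smul]
      _ = ‖∑ j, (T i j : ℂ) * x j‖ := by rw [← hmul]; rfl
      _ ≤ ∑ j, T i j * (t * v j) := by
        refine norm_sum_le_of_le _ fun j _ => ?_
        rw [norm_mul, Complex.norm_real, Real.norm_of_nonneg (hT i j)]
        exact mul_le_mul_of_nonneg_left (hxt j) (hT i j)
      _ = t * T.mulVec v i := by
        rw [Matrix.mulVec, dotProduct, Finset.mul_sum]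
        exact Finset.sum_congr rfl fun j _ => by ring
      _ ≤ t * (c * v i) := mul_le_mul_of_nonneg_left (h i) ht0.le
      _ = c * (t * v i) := by ring
  have hμc : ‖μ‖ ≤ c := le_of_mul_le_mul_right key (mul_pos ht0 (hv i))
  rw [← enorm_eq_nnnorm, ← ofReal_norm]
  exact ENNReal.ofReal_le_ofReal hμc

namespace AsyncSchur

open Matrix

/-! ### Entrywise estimates with positive weights. -/

section Estimates

variable {𝕜 : Type*} [RCLike 𝕜] {m n : Type*}

theorem absMat_nonneg (B : Matrix m n 𝕜) (i : m) (j : n) : 0 ≤ absMat B i j :=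
  norm_nonneg (B i j)

variable [Fintype n]

theorem norm_mulVec_le (N : Matrix m n 𝕜) {x : n → 𝕜} {v : n → ℝ} (hx : ∀ j, ‖x j‖ ≤ v j)
    (i : m) : ‖(N *ᵥ x) i‖ ≤ (absMat N *ᵥ v) i := by
  refine norm_sum_le_of_le _ fun j _ => ?_
  rw [norm_mul]
  exact mul_le_mul_of_nonneg_left (hx j) (norm_nonneg _)

theorem norm_mulVec_le_mul (N : Matrix m n 𝕜) {x : n → 𝕜} {v : n → ℝ} {t : ℝ}
    (hx : ∀ j, ‖x j‖ ≤ t * v j) (i : m) : ‖(N *ᵥ x) i‖ ≤ t * (absMat N *ᵥ v) i := by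
  have h := norm_mulVec_le N (v := t • v) hx i
  rwa [Matrix.mulVec_smul] at h

/-- The bound in `norm_mulVec_le` is attained in every row. -/
theorem absMat_mulVec_le_of_forall (B : Matrix m n 𝕜) {v : n → ℝ} (hv : ∀ j, 0 ≤ v j) {i : m}
    {C : ℝ} (h : ∀ x : n → 𝕜, (∀ j, ‖x j‖ ≤ v j) → ‖(B *ᵥ x) i‖ ≤ C) :
    (absMat B *ᵥ v) i ≤ C := by
  -- Conjugate phases make all terms of row `i` add up without cancellation; at zero entries `0 / 0
  -- = 0` is harmless.
  have hx := h (fun j => (starRingEnd 𝕜 (B i j) / (‖B i j‖ : 𝕜)) * (v j : 𝕜)) fun j => by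
    rw [norm_mul, norm_div, RCLike.norm_conj, RCLike.norm_ofReal, RCLike.norm_ofReal, abs_norm,
      abs_of_nonneg (hv j)]
    exact mul_le_of_le_one_left (hv j) (div_self_le_one _)
  refine le_trans (le_of_eq ?_) hx
  have hsum : (B *ᵥ fun j => (starRingEnd 𝕜 (B i j) / (‖B i j‖ : 𝕜)) * (v j : 𝕜)) i =
      (((absMat B *ᵥ v) i : ℝ) : 𝕜) := by
    simp only [Matrix.mulVec, dotProduct, absMat, Matrix.of_apply, map_sum, RCLike.ofReal_mul]
    refine Finset.sum_congr rfl fun j _ => ?_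
    rcases eq_or_ne (B i j) 0 with h0 | h0
    · simp [h0]
    · have h1 : (‖B i j‖ : 𝕜) ≠ 0 := by simpa using h0
      rw [← mul_assoc, ← mul_div_assoc, RCLike.mul_conj, sq, mul_div_assoc, div_self h1, mul_one]
  rw [hsum, RCLike.norm_ofReal, abs_of_nonneg]
  exact Finset.sum_nonneg fun j _ => mul_nonneg (absMat_nonneg B i j) (hv j)

theorem exists_lt_one_forall_le_mul {a b : n → ℝ} (hb : ∀ i, 0 < b i) (hab : ∀ i, a i < b i) :
    ∃ c : ℝ, 0 ≤ c ∧ c < 1 ∧ ∀ i, a i ≤ c * b i := by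
  have hev : ∀ᶠ c in 𝓝[<] (1 : ℝ), ∀ i, a i ≤ c * b i := by
    refine Filter.eventually_all.2 fun i => ?_
    have hlt : a i / b i < 1 := (div_lt_one (hb i)).2 (hab i)
    filter_upwards [Ioo_mem_nhdsLT hlt] with c hc
    exact (div_le_iff₀ (hb i)).1 hc.1.le
  obtain ⟨c, hc, h0, h1⟩ := (hev.and (Ioo_mem_nhdsLT (zero_lt_one' ℝ))).exists
  exact ⟨c, h0.le, h1, hc⟩

variable [DecidableEq n]

theorem compMat_mulVec_apply (M : Matrix n n 𝕜) (w : n → ℝ) (i : n) :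
    (compMat M *ᵥ w) i = ‖M i i‖ * w i - ∑ j ∈ Finset.univ.erase i, ‖M i j‖ * w j := by
  rw [Matrix.mulVec, dotProduct, ← Finset.add_sum_erase _ _ (Finset.mem_univ i), sub_eq_add_neg,
    ← Finset.sum_neg_distrib]
  congr 1
  · simp [compMat]
  · refine Finset.sum_congr rfl fun j hj => ?_
    simp [compMat, (Finset.ne_of_mem_erase hj).symm]

/-- `M x = y` and `|y| ≤ c ⟨M⟩ w` imply `|x| ≤ c w` if `w` and `⟨M⟩ w` are positive. -/
theorem norm_le_of_norm_mulVec_le {M : Matrix n n 𝕜} {w : n → ℝ} (hw : ∀ i, 0 < w i)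
    (hMw : ∀ i, 0 < (compMat M *ᵥ w) i) {c : ℝ} {x : n → 𝕜}
    (h : ∀ i, ‖(M *ᵥ x) i‖ ≤ c * (compMat M *ᵥ w) i) (i : n) : ‖x i‖ ≤ c * w i := by
  have : Nonempty n := ⟨i⟩
  obtain ⟨l, hl⟩ := Finite.exists_max fun i => ‖x i‖ / w i
  set t := ‖x l‖ / w l
  have hxt : ∀ j, ‖x j‖ ≤ t * w j := fun j => (div_le_iff₀ (hw j)).1 (hl j)
  have hxl : ‖x l‖ = t * w l := (div_mul_cancel₀ _ (hw l).ne').symm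
  have key : t * (compMat M *ᵥ w) l ≤ c * (compMat M *ᵥ w) l := by
    refine le_trans ?_ (h l)
    have hsplit : (M *ᵥ x) l = M l l * x l + ∑ j ∈ Finset.univ.erase l, M l j * x j :=
      (Finset.add_sum_erase _ _ (Finset.mem_univ l)).symm
    have hrest : ‖∑ j ∈ Finset.univ.erase l, M l j * x j‖ ≤
        t * ∑ j ∈ Finset.univ.erase l, ‖M l j‖ * w j := by
      rw [Finset.mul_sum]
      refine norm_sum_le_of_le _ fun j _ => ?_
      rw [norm_mul, mul_left_comm]
      exact mul_le_mul_of_nonneg_left (hxt j) (norm_nonneg _)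
    have hdiag : ‖M l l * x l‖ = t * (‖M l l‖ * w l) := by
      rw [norm_mul, hxl]; ring
    have htri := norm_sub_le_norm_add (M l l * x l) (∑ j ∈ Finset.univ.erase l, M l j * x j)
    rw [compMat_mulVec_apply, hsplit, mul_sub]
    linarith
  exact (hxt i).trans (mul_le_mul_of_nonneg_right (le_of_mul_le_mul_right key (hMw l)) (hw i).le)

theorem isUnit_of_compMat_mulVec_pos {M : Matrix n n 𝕜} {w : n → ℝ} (hw : ∀ i, 0 < w i)
    (hMw : ∀ i, 0 < (compMat M *ᵥ w) i) : IsUnit M := by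
  refine Matrix.mulVec_injective_iff_isUnit.1 fun x y hxy => ?_
  funext i
  have h := norm_le_of_norm_mulVec_le hw hMw (c := 0) (x := x - y) (fun i => by
    rw [Matrix.mulVec_sub, hxy, sub_self]; simp) i
  rw [zero_mul, norm_le_zero_iff] at h
  exact sub_eq_zero.1 h

theorem mulVec_inv_mulVec {M : Matrix n n 𝕜} (hM : IsUnit M) (y : n → 𝕜) :
    M *ᵥ (M⁻¹ *ᵥ y) = y := by
  rw [Matrix.mulVec_mulVec, Matrix.mul_nonsing_inv _ ((Matrix.isUnit_iff_isUnit_det M).1 hM),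
    Matrix.one_mulVec]

/-- `|N| v ≤ c ⟨M⟩ w` implies `|M⁻¹ N| v ≤ c w`. -/
theorem absMat_inv_mul_mulVec_le {κ : Type*} [Fintype κ] {M : Matrix n n 𝕜} {w : n → ℝ}
    (hw : ∀ i, 0 < w i) (hMw : ∀ i, 0 < (compMat M *ᵥ w) i) {N : Matrix n κ 𝕜} {v : κ → ℝ}
    (hv : ∀ j, 0 ≤ v j) {c : ℝ} (h : ∀ i, (absMat N *ᵥ v) i ≤ c * (compMat M *ᵥ w) i) (i : n) :
    (absMat (M⁻¹ * N) *ᵥ v) i ≤ c * w i := by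
  -- Testing on vectors `|x| ≤ v` reduces the claim to solving `M z = N x`, so no entrywise bound on
  -- `M⁻¹` is needed.
  refine absMat_mulVec_le_of_forall _ hv fun x hx => ?_
  refine norm_le_of_norm_mulVec_le hw hMw (fun l => ?_) i
  rw [← Matrix.mulVec_mulVec, mulVec_inv_mulVec (isUnit_of_compMat_mulVec_pos hw hMw)]
  exact (norm_mulVec_le N hx l).trans (h l)

end Estimates

/-! ### Convergence of asynchronous iterations. -/

/-- Asynchronous iterations with a map that contracts a weighted maximum norm towards `0`
converge to `0`. -/
theorem tendsto_zero_of_isAsyncSchedule {𝕜 : Type*} [RCLike 𝕜] {p : ℕ} {Γ : Type*} [Finite Γ]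
    {w : Γ → ℝ} (hw : ∀ g, 0 < w g) {c : ℝ} (hc0 : 0 ≤ c) (hc1 : c < 1)
    {F : (Fin p → Γ → 𝕜) → Γ → 𝕜}
    (hF : ∀ t, 0 ≤ t → ∀ e : Fin p → Γ → 𝕜, (∀ j g, ‖e j g‖ ≤ t * w g) →
      ∀ g, ‖F e g‖ ≤ c * t * w g)
    {P : ℕ → Set (Fin p)} {τ : Fin p → Fin p → ℕ → ℕ} (hs : IsAsyncSchedule P τ)
    {e : ℕ → Fin p → Γ → 𝕜}
    (he : ∀ k i, (i ∈ P k → e (k + 1) i = F fun j => e (τ i j k) j) ∧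
      (i ∉ P k → e (k + 1) i = e k i)) (i : Fin p) :
    Tendsto (fun k => e k i) atTop (𝓝 0) := by
  obtain ⟨R, hR0, hR⟩ : ∃ R : ℝ, 0 ≤ R ∧ ∀ i g, ‖e 0 i g‖ ≤ R * w g := by
    obtain ⟨R, hR⟩ := (Set.finite_range fun q : Fin p × Γ => ‖e 0 q.1 q.2‖ / w q.2).bddAbove
    refine ⟨max R 0, le_max_right _ _, fun i g => ?_⟩
    exact (div_le_iff₀ (hw g)).1 ((hR ⟨(i, g), rfl⟩).trans (le_max_left _ _))
  -- All earlier times are kept in the induction because a delay may reach back to any of them.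
  have hbound : ∀ k, ∀ l ≤ k, ∀ i g, ‖e l i g‖ ≤ R * w g := by
    intro k
    induction k with
    | zero =>
      intro l hl i g
      rw [Nat.le_zero.1 hl]
      exact hR i g
    | succ k ih =>
      intro l hl i g
      rcases Nat.le_succ_iff.1 hl with hl | rfl
      · exact ih l hl i g
      by_cases hi : i ∈ P k
      · rw [(he k i).1 hi]
        refine (hF R hR0 _ (fun j g => ih _ (hs.delay_le i j k) j g) g).trans ?_
        exact mul_le_mul_of_nonneg_right (mul_le_of_le_one_left hR0 hc1.le) (hw g).le
      · rw [(he k i).2 hi]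
        exact ih k le_rfl i g
  -- Nested boxes: once all data read lie in box `m`, each component enters box `m + 1` at its next
  -- update and never leaves it.
  have hdecay : ∀ m : ℕ, ∀ᶠ k in atTop, ∀ i g, ‖e k i g‖ ≤ c ^ m * R * w g := by
    intro m
    induction m with
    | zero => exact Eventually.of_forall fun k i g => by simpa using hbound k k le_rfl i g
    | succ m ih =>
      have hacc : ∀ᶠ k in atTop, ∀ i j g, ‖e (τ i j k) j g‖ ≤ c ^ m * R * w g := by
        refine Filter.eventually_all.2 fun i => Filter.eventually_all.2 fun j => ?_
        filter_upwards [(hs.delay_tendsto i j).eventually ih] with k hk using hk j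
      obtain ⟨K, hK⟩ := Filter.eventually_atTop.1 hacc
      have hupd : ∀ k, K ≤ k → ∀ i, i ∈ P k → ∀ g, ‖e (k + 1) i g‖ ≤ c ^ (m + 1) * R * w g := by
        intro k hk i hi g
        rw [(he k i).1 hi]
        refine (hF (c ^ m * R) (by positivity) _ (hK k hk i) g).trans (le_of_eq ?_)
        ring
      refine Filter.eventually_all.2 fun i => ?_
      obtain ⟨l, hlP, hKl⟩ := (hs.infinite_updates i).exists_gt K
      filter_upwards [Filter.eventually_ge_atTop (l + 1)] with k hk
      induction k, hk using Nat.le_induction with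
      | base => exact hupd l hKl.le i hlP
      | succ k hk ihk =>
        by_cases hi : i ∈ P k
        · exact hupd k (by omega) i hi
        · rw [(he k i).2 hi]
          exact ihk
  refine tendsto_pi_nhds.2 fun g => ?_
  rw [Metric.tendsto_nhds]
  intro ε hε
  have hlim : Tendsto (fun m : ℕ => c ^ m * R * w g) atTop (𝓝 0) := by
    simpa using ((tendsto_pow_atTop_nhds_zero_of_lt_one hc0 hc1).mul_const R).mul_const (w g)
  obtain ⟨m, hm⟩ := (hlim.eventually_lt_const hε).exists
  filter_upwards [hdecay m] with k hk
  rw [Pi.zero_apply, dist_zero_right]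
  exact (hk i g).trans_lt hm

theorem exists_dominant_weights {𝕜 : Type*} [RCLike 𝕜] {n : Type*} [Fintype n] [DecidableEq n]
    {A M : Matrix n n 𝕜} (hA : IsHMatrix A) (hM : compMat M - absMat (M - A) = compMat A) :
    ∃ (v : n → ℝ) (c : ℝ), (∀ i, 0 < v i) ∧ (∀ i, 0 < (compMat M *ᵥ v) i) ∧ 0 ≤ c ∧ c < 1 ∧
      ∀ i, (absMat (M - A) *ᵥ v) i ≤ c * (compMat M *ᵥ v) i := by
  obtain ⟨v, hv, hAv⟩ := IsMMatrix.exists_pos_mulVec_pos hA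
  have hlt : ∀ i, (absMat (M - A) *ᵥ v) i < (compMat M *ᵥ v) i := fun i => by
    have := hAv i
    rwa [← hM, Matrix.sub_mulVec, Pi.sub_apply, sub_pos] at this
  have hMv : ∀ i, 0 < (compMat M *ᵥ v) i := fun i =>
    (Finset.sum_nonneg fun j _ => mul_nonneg (absMat_nonneg (M - A) i j) (hv j).le).trans_lt (hlt i)
  obtain ⟨c, hc0, hc1, hc⟩ := exists_lt_one_forall_le_mul hMv hlt
  exact ⟨v, c, hv, hMv, hc0, hc1, hc⟩

theorem one_sub_inv_mul {𝕜 : Type*} [RCLike 𝕜] {n : Type*} [Fintype n] [DecidableEq n]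
    {M : Matrix n n 𝕜} (hM : IsUnit M) (A : Matrix n n 𝕜) : 1 - M⁻¹ * A = M⁻¹ * (M - A) := by
  rw [Matrix.mul_sub, Matrix.nonsing_inv_mul _ ((Matrix.isUnit_iff_isUnit_det M).1 hM)]

/-! ### The subdomain splitting and its contraction estimate. -/

namespace SubdomainData

variable {𝕜 : Type*} [RCLike 𝕜] {p : ℕ} {ι : Fin p → Type*} {Γ : Type*}
  [∀ i, Fintype (ι i)] [∀ i, DecidableEq (ι i)] [Fintype Γ] [DecidableEq Γ]
  (D : SubdomainData 𝕜 p ι Γ) (MGG : Matrix Γ Γ 𝕜)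

-- Outside the interface block, either `M` and `A` agree or `M` vanishes, so only the interface
-- block needs the hypothesis.
omit [∀ i, Fintype (ι i)] [Fintype Γ] in
theorem compMat_splittingMatrix_sub
    (hM : compMat MGG - absMat (MGG - D.interfaceBlock) = compMat D.interfaceBlock) :
    compMat (D.splittingMatrix MGG) - absMat (D.splittingMatrix MGG - D.globalMatrix) =
      compMat D.globalMatrix := by
  ext (a | g) (b | h)
  · simp [compMat, absMat, splittingMatrix, globalMatrix]
  · simp [compMat, absMat, splittingMatrix, globalMatrix]
  · simp [compMat, absMat, splittingMatrix, globalMatrix]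
  · have := congrFun (congrFun hM g) h
    simpa [compMat, absMat, splittingMatrix, globalMatrix] using this

theorem compMat_splittingMatrix_mulVec_inl (v : (Σ i, ι i) ⊕ Γ → ℝ) (i : Fin p) (a : ι i) :
    (compMat (D.splittingMatrix MGG) *ᵥ v) (Sum.inl ⟨i, a⟩) =
      (compMat (D.AII i) *ᵥ fun b => v (Sum.inl ⟨i, b⟩)) a := by
  simp only [Matrix.mulVec, dotProduct, Fintype.sum_sum_type, Fintype.sum_sigma]
  rw [Finset.sum_eq_single i]
  · simp [compMat, splittingMatrix, Matrix.blockDiagonal'_apply]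
  · intro j _ hj
    refine Finset.sum_eq_zero fun b _ => ?_
    simp [compMat, splittingMatrix, Matrix.blockDiagonal'_apply, hj.symm]
  · simp

theorem compMat_splittingMatrix_mulVec_inr (v : (Σ i, ι i) ⊕ Γ → ℝ) (g : Γ) :
    (compMat (D.splittingMatrix MGG) *ᵥ v) (Sum.inr g) =
      (compMat MGG *ᵥ fun h => v (Sum.inr h)) g := by
  simp [Matrix.mulVec, dotProduct, compMat, splittingMatrix]

omit [∀ i, DecidableEq (ι i)] [DecidableEq Γ] in
theorem absMat_splittingMatrix_sub_mulVec_inl (v : (Σ i, ι i) ⊕ Γ → ℝ) (i : Fin p) (a : ι i) :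
    (absMat (D.splittingMatrix MGG - D.globalMatrix) *ᵥ v) (Sum.inl ⟨i, a⟩) =
      (absMat (D.AIG i) *ᵥ fun h => v (Sum.inr h)) a := by
  simp [Matrix.mulVec, dotProduct, absMat, splittingMatrix, globalMatrix]

/-- The interface rows of `M - A`. -/
def interfaceRows : Matrix Γ ((Σ i, ι i) ⊕ Γ) 𝕜 :=
  Matrix.fromCols (Matrix.of fun (g : Γ) (a : Σ i, ι i) => -D.AGI a.1 g a.2)
    (MGG - D.interfaceBlock)

omit [∀ i, DecidableEq (ι i)] [DecidableEq Γ] in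
theorem absMat_splittingMatrix_sub_mulVec_inr (v : (Σ i, ι i) ⊕ Γ → ℝ) (g : Γ) :
    (absMat (D.splittingMatrix MGG - D.globalMatrix) *ᵥ v) (Sum.inr g) =
      (absMat (D.interfaceRows MGG) *ᵥ v) g := by
  simp [Matrix.mulVec, dotProduct, absMat, splittingMatrix, globalMatrix, interfaceRows]

/-- The linear part of one asynchronous update. -/
noncomputable def updateLinear (W : Fin p → Matrix Γ Γ 𝕜) (e : Fin p → Γ → 𝕜) : Γ → 𝕜 :=
  ∑ j, (W j - MGG⁻¹ * D.localSchur j) *ᵥ e j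

theorem contribution_sub (W : Fin p → Matrix Γ Γ 𝕜) (i : Fin p) (x y : Γ → 𝕜) :
    D.contribution MGG W i x - D.contribution MGG W i y =
      (W i - MGG⁻¹ * D.localSchur i) *ᵥ (x - y) := by
  simp only [contribution, Matrix.sub_mulVec, Matrix.mulVec_sub, Matrix.mulVec_mulVec]
  abel

theorem sum_contribution {W : Fin p → Matrix Γ Γ 𝕜} (hW : ∑ i, W i = 1) (x : Γ → 𝕜) :
    ∑ i, D.contribution MGG W i x = x + MGG⁻¹ *ᵥ (D.rhs - D.schur *ᵥ x) := by
  simp only [contribution, Finset.sum_add_distrib, ← Matrix.sum_mulVec, hW, Matrix.one_mulVec,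
    rhs, schur, ← Matrix.mulVec_sum, Finset.sum_sub_distrib]

theorem norm_updateLinear_le {W : Fin p → Matrix Γ Γ 𝕜} (hW : ∑ i, W i = 1)
    (hsum : ∑ i, absMat (W i - MGG⁻¹ * D.AGG i) = absMat (∑ i, (W i - MGG⁻¹ * D.AGG i)))
    {v : (Σ i, ι i) ⊕ Γ → ℝ} (hv : ∀ i, 0 < v i) {c : ℝ} (hc1 : c ≤ 1)
    (hMv : ∀ i, 0 < (compMat (D.splittingMatrix MGG) *ᵥ v) i)
    (hc : ∀ i, (absMat (D.splittingMatrix MGG - D.globalMatrix) *ᵥ v) i ≤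
      c * (compMat (D.splittingMatrix MGG) *ᵥ v) i)
    {t : ℝ} (ht : 0 ≤ t) {e : Fin p → Γ → 𝕜} (he : ∀ j g, ‖e j g‖ ≤ t * v (Sum.inr g)) (g : Γ) :
    ‖D.updateLinear MGG W e g‖ ≤ c * t * v (Sum.inr g) := by
  set w : Γ → ℝ := fun h => v (Sum.inr h)
  have hw : ∀ h, 0 < w h := fun h => hv _
  have hMw : ∀ h, 0 < (compMat MGG *ᵥ w) h := fun h => by
    rw [← D.compMat_splittingMatrix_mulVec_inr MGG v]
    exact hMv _
  have hMu : IsUnit MGG := isUnit_of_compMat_mulVec_pos hw hMw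
  have hI : ∀ i a, 0 < (compMat (D.AII i) *ᵥ fun b => v (Sum.inl ⟨i, b⟩)) a := fun i a => by
    rw [← D.compMat_splittingMatrix_mulVec_inl MGG v]
    exact hMv _
  -- Reintroducing the eliminated interior unknowns (up to sign) lets the Schur complement be
  -- estimated by rows of the global matrix.
  set f : (i : Fin p) → ι i → 𝕜 := fun i => (D.AII i)⁻¹ *ᵥ (D.AIG i *ᵥ e i) with hf
  have hfle : ∀ i a, ‖f i a‖ ≤ t * v (Sum.inl ⟨i, a⟩) := by
    intro i
    refine norm_le_of_norm_mulVec_le (fun _ => hv _) (hI i) fun a => ?_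
    rw [mulVec_inv_mulVec (isUnit_of_compMat_mulVec_pos (fun _ => hv _) (hI i))]
    refine (norm_mulVec_le_mul (D.AIG i) (v := w) (he i) a).trans ?_
    have h1 := hc (Sum.inl ⟨i, a⟩)
    rw [D.absMat_splittingMatrix_sub_mulVec_inl, D.compMat_splittingMatrix_mulVec_inl] at h1
    exact mul_le_mul_of_nonneg_left (h1.trans (mul_le_of_le_one_left (hI i a).le hc1)) ht
  have hN := absMat_inv_mul_mulVec_le hw hMw (N := D.interfaceRows MGG) (v := v)
    (fun j => (hv j).le) (c := c) (fun h => by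
      have := hc (Sum.inr h)
      rwa [D.absMat_splittingMatrix_sub_mulVec_inr, D.compMat_splittingMatrix_mulVec_inr] at this) g
  set G : Matrix Γ (Σ i, ι i) 𝕜 :=
    Matrix.of fun (g : Γ) (a : Σ i, ι i) => -D.AGI a.1 g a.2 with hG
  have hNsplit : (absMat (MGG⁻¹ * D.interfaceRows MGG) *ᵥ v) g =
      (absMat (MGG⁻¹ * G) *ᵥ fun a => v (Sum.inl a)) g +
        (absMat (MGG⁻¹ * (MGG - D.interfaceBlock)) *ᵥ w) g := by
    simp only [Matrix.mulVec, dotProduct, Fintype.sum_sum_type]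
    rfl
  have hdecomp : D.updateLinear MGG W e =
      ∑ j, (W j - MGG⁻¹ * D.AGG j) *ᵥ e j - (MGG⁻¹ * G) *ᵥ fun a => f a.1 a.2 := by
    have hGf : (G *ᵥ fun a => f a.1 a.2) = -∑ j, D.AGI j *ᵥ f j := by
      funext h
      simp [hG, Matrix.mulVec, dotProduct, Fintype.sum_sigma]
    rw [← Matrix.mulVec_mulVec, hGf, Matrix.mulVec_neg, sub_neg_eq_add, Matrix.mulVec_sum,
      ← Finset.sum_add_distrib]
    refine Finset.sum_congr rfl fun j _ => ?_
    simp only [hf, localSchur, Matrix.mul_sub, Matrix.sub_mulVec, Matrix.mulVec_mulVec,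
      Matrix.mul_assoc]
    abel
  -- The `e j` differ, so the triangle inequality yields the sum of absolute values; `hsum`
  -- identifies it with the absolute value of the sum.
  have hfirst : ‖(∑ j, (W j - MGG⁻¹ * D.AGG j) *ᵥ e j) g‖ ≤
      t * (absMat (MGG⁻¹ * (MGG - D.interfaceBlock)) *ᵥ w) g := by
    have hid : ∑ i, (W i - MGG⁻¹ * D.AGG i) = MGG⁻¹ * (MGG - D.interfaceBlock) := by
      rw [Finset.sum_sub_distrib, hW, ← Matrix.mul_sum, ← one_sub_inv_mul hMu]
      rfl
    rw [← hid, ← hsum, Matrix.sum_mulVec, Finset.sum_apply, Finset.sum_apply, Finset.mul_sum]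
    exact norm_sum_le_of_le _ fun j _ =>
      norm_mulVec_le_mul (W j - MGG⁻¹ * D.AGG j) (v := w) (he j) g
  have hsecond : ‖((MGG⁻¹ * G) *ᵥ fun a => f a.1 a.2) g‖ ≤
      t * (absMat (MGG⁻¹ * G) *ᵥ fun a => v (Sum.inl a)) g :=
    norm_mulVec_le_mul (MGG⁻¹ * G) (fun a => hfle a.1 a.2) g
  rw [hdecomp, Pi.sub_apply]
  refine (norm_sub_le _ _).trans ((add_le_add hfirst hsecond).trans ?_)
  rw [← mul_add, add_comm, ← hNsplit, mul_comm c t, mul_assoc]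
  exact mul_le_mul_of_nonneg_left hN ht

/-! ### Convergence of the method and the main theorem. -/

theorem asyncSchurConvergent_of_updateLinear {W : Fin p → Matrix Γ Γ 𝕜} (hW : ∑ i, W i = 1)
    {w : Γ → ℝ} (hw : ∀ g, 0 < w g) {c : ℝ} (hc0 : 0 ≤ c) (hc1 : c < 1)
    (hF : ∀ t, 0 ≤ t → ∀ e : Fin p → Γ → 𝕜, (∀ j g, ‖e j g‖ ≤ t * w g) →
      ∀ g, ‖D.updateLinear MGG W e g‖ ≤ c * t * w g) :
    AsyncSchurConvergent D MGG W := by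
  have hconst : ∀ z : Γ → 𝕜, D.updateLinear MGG W (fun _ => z) = z - MGG⁻¹ *ᵥ (D.schur *ᵥ z) := by
    intro z
    simp only [updateLinear, ← Matrix.sum_mulVec, Finset.sum_sub_distrib, hW, Matrix.sub_mulVec,
      Matrix.one_mulVec, ← Matrix.mulVec_mulVec, ← Matrix.mulVec_sum, schur]
  have hS : IsUnit D.schur := by
    refine Matrix.mulVec_injective_iff_isUnit.1 fun x y hxy => ?_
    -- Without subdomains, `hW` says `1 = 0`, so all interface vectors coincide.
    by_cases hp : IsEmpty (Fin p)
    · have h1 : (1 : Matrix Γ Γ 𝕜) = 0 := by rw [← hW]; exact Fintype.sum_empty _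
      rw [← Matrix.one_mulVec x, ← Matrix.one_mulVec y, h1, Matrix.zero_mulVec, Matrix.zero_mulVec]
    obtain ⟨i⟩ := not_isEmpty_iff.1 hp
    have hfix : D.updateLinear MGG W (fun _ => x - y) = x - y := by
      rw [hconst, Matrix.mulVec_sub, hxy, sub_self, Matrix.mulVec_zero, sub_zero]
    -- A kernel vector of `D.schur` is a constant run of the synchronous iteration, hence zero.
    have hlim := tendsto_zero_of_isAsyncSchedule hw hc0 hc1 hF (P := fun _ => Set.univ)
      (τ := fun _ _ k => k)
      ⟨fun i => by simpa using Set.infinite_univ, fun _ _ _ => le_rfl, fun _ _ => tendsto_id⟩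
      (e := fun _ _ => x - y) (fun k i => ⟨fun _ => hfix.symm, fun _ => rfl⟩) i
    exact sub_eq_zero.1 (tendsto_nhds_unique tendsto_const_nhds hlim)
  have hxs : D.schur *ᵥ (D.schur⁻¹ *ᵥ D.rhs) = D.rhs := mulVec_inv_mulVec hS _
  refine ⟨D.schur⁻¹ *ᵥ D.rhs, fun z => ⟨fun hz => ?_, fun hz => hz ▸ hxs⟩, ?_⟩
  · exact Matrix.mulVec_injective_iff_isUnit.2 hS (hz.trans hxs.symm)
  intro P τ hs x hx i
  set xs := D.schur⁻¹ *ᵥ D.rhs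
  have hfix : xs = ∑ j, D.contribution MGG W j xs := by
    rw [D.sum_contribution MGG hW, hxs, sub_self, Matrix.mulVec_zero, add_zero]
  have hlim := tendsto_zero_of_isAsyncSchedule hw hc0 hc1 hF hs (e := fun k j => x k j - xs)
    (fun k i => ⟨fun hi => by
      rw [(hx k i).1 hi]
      conv_lhs => rw [hfix, ← Finset.sum_sub_distrib]
      exact Finset.sum_congr rfl fun j _ => D.contribution_sub MGG W j _ _,
    fun hi => by rw [(hx k i).2 hi]⟩) i
  simpa using hlim.add_const xs

end SubdomainData

end AsyncSchur

theorem mainTheorem3 {𝕜 : Type*} [RCLike 𝕜] {p : ℕ} {ι : Fin p → Type*} {Γ : Type*}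
    [∀ i, Fintype (ι i)] [∀ i, DecidableEq (ι i)] [Fintype Γ] [DecidableEq Γ]
    (D : AsyncSchur.SubdomainData 𝕜 p ι Γ) (MGG : Matrix Γ Γ 𝕜)
    (W : Fin p → Matrix Γ Γ 𝕜) (hW : ∑ i, W i = 1)
    (hsum : ∑ i, AsyncSchur.absMat (W i - MGG⁻¹ * D.AGG i) =
      AsyncSchur.absMat (∑ i, (W i - MGG⁻¹ * D.AGG i)))
    (hA : AsyncSchur.IsHMatrix D.globalMatrix)
    (hM : AsyncSchur.compMat MGG - AsyncSchur.absMat (MGG - D.interfaceBlock) =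
      AsyncSchur.compMat D.interfaceBlock) :
    AsyncSchur.AsyncSchurConvergent D MGG W ∧
    AsyncSchur.IsHSplitting D.globalMatrix (D.splittingMatrix MGG)
      (D.splittingMatrix MGG - D.globalMatrix) ∧
    AsyncSchur.specRad (AsyncSchur.absMat (1 - (D.splittingMatrix MGG)⁻¹ * D.globalMatrix)) < 1 := by
  have hcomp := D.compMat_splittingMatrix_sub MGG hM
  obtain ⟨v, c, hv, hMv, hc0, hc1, hc⟩ := AsyncSchur.exists_dominant_weights hA hcomp
  have hunit := AsyncSchur.isUnit_of_compMat_mulVec_pos hv hMv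
  refine ⟨?_, ⟨(sub_sub_cancel _ _).symm, hunit, ?_⟩, ?_⟩
  · exact D.asyncSchurConvergent_of_updateLinear MGG hW (fun g => hv (Sum.inr g)) hc0 hc1
      fun t ht e he => D.norm_updateLinear_le MGG hW hsum hv hc1.le hMv hc ht he
  · rw [hcomp]
    exact hA
  · rw [AsyncSchur.one_sub_inv_mul hunit]
    have hle := AsyncSchur.absMat_inv_mul_mulVec_le hv hMv (fun j => (hv j).le) hc
    exact (AsyncSchur.specRad_le_of_mulVec_le (AsyncSchur.absMat_nonneg _) hv hle).trans_lt
      (ENNReal.ofReal_lt_one.2 hc1)
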